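/- **Lemma 6.2.** Let $G$ be a compact Lie group (real and finite-dimensional, not necessarily connected), and let $g_+, g_- \in G$ satisfy $g_+^2 = g_-^2$. Let $G_0$ denote the identity component of $G$. Then there exists $h \in G_0$ such that $(h g_- h^{-1})^{-1} g_+$ has finite order. -/

import Mathlib

open scoped Manifold ContDiff

/-! Put `A = gm⁻¹ * gp`; equality of squares makes `gp` invert `A`. If `h` commutes with `A` and is
inverted by `gp`, then `(h * gm * h⁻¹)⁻¹ * gp = A * h ^ 2`. By compactness some `A⁻¹ ^ n` with `n >
0` lies near `1`; taking for `h` a `2n`-th root of it gives `(A * h ^ 2) ^ n = 1`. The root must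
inherit the symmetries of `A⁻¹ ^ n`, on a neighbourhood chosen before `n` is known. This is
`LieGroup.exists_uniform_roots`: in a chart the `m`-th power map is `x ↦ m • x` up to relative error
1/2 on a ball of radius `r / m`, so small roots exist by contraction and are unique in that ball. -/

open Filter Topology Metric

/-! ### Power maps of a local multiplication on a normed space. -/

section LocalPowers

variable {E : Type*} [NormedAddCommGroup E] [NormedSpace ℝ E]

/-- Mixed second differences of a `C²` map are bounded bilinearly. -/
theorem ContDiffAt.exists_norm_mixed_difference_le {F : Type*} [NormedAddCommGroup F]
    [NormedSpace ℝ F] {P : E × E → F} (hP : ContDiffAt ℝ 2 P 0) :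
    ∃ C : ℝ, 0 ≤ C ∧ ∃ ρ > 0, ∀ x x' y y' : E, ‖x‖ < ρ → ‖x'‖ < ρ → ‖y‖ < ρ → ‖y'‖ < ρ →
      ‖(P (x, y) - P (x', y)) - (P (x, y') - P (x', y'))‖ ≤ C * ‖x - x'‖ * ‖y - y'‖ := by
  obtain ⟨K, t, ht, hK⟩ :=
    (hP.fderiv_right (m := 1) (by norm_num [one_add_one_eq_two])).exists_lipschitzOnWith
  have hd : ∀ᶠ z in 𝓝 (0 : E × E), DifferentiableAt ℝ P z :=
    (hP.eventually (by simp)).mono fun z hz => hz.differentiableAt (by simp)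
  obtain ⟨ρ, hρ, hball⟩ := Metric.eventually_nhds_iff_ball.1 (hd.and ht)
  have hmem : ∀ {x y : E}, ‖x‖ < ρ → ‖y‖ < ρ → (x, y) ∈ ball (0 : E × E) ρ := fun hx hy => by
    rw [mem_ball_zero_iff, Prod.norm_def]; exact max_lt hx hy
  refine ⟨K, K.2, ρ, hρ, fun x x' y y' hx hx' hy hy' => ?_⟩
  have hder : ∀ u : E, ‖u‖ < ρ → ∀ v ∈ ball (0 : E) ρ, HasFDerivAt (fun w => P (u, w))
      ((fderiv ℝ P (u, v)).comp (ContinuousLinearMap.inr ℝ E E)) v := fun u hu v hv =>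
    (hball _ (hmem hu (mem_ball_zero_iff.1 hv))).1.hasFDerivAt.comp v (hasFDerivAt_prodMk_right u v)
  -- Mean value inequality in the second variable; the derivative is at most `K * ‖x - x'‖` because
  -- `fderiv ℝ P` is `K`-Lipschitz.
  refine (convex_ball (0 : E) ρ).norm_image_sub_le_of_norm_hasFDerivWithin_le
    (f := fun w => P (x, w) - P (x', w))
    (fun v hv => ((hder x hx v hv).sub (hder x' hx' v hv)).hasFDerivWithinAt)
    (fun v hv => ?_) (mem_ball_zero_iff.2 hy') (mem_ball_zero_iff.2 hy)
  have hv' := mem_ball_zero_iff.1 hv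
  rw [← ContinuousLinearMap.sub_comp]
  refine (ContinuousLinearMap.opNorm_comp_le _ _).trans ?_
  have h1 := hK.norm_sub_le (hball _ (hmem hx hv')).2 (hball _ (hmem hx' hv')).2
  rw [Prod.mk_sub_mk, sub_self, Prod.norm_mk, norm_zero, max_eq_left (norm_nonneg _)] at h1
  calc _ ≤ (K * ‖x - x'‖) * 1 :=
        mul_le_mul h1 (ContinuousLinearMap.norm_inr_le_one ℝ E E) (norm_nonneg _) (by positivity)
    _ = K * ‖x - x'‖ := mul_one _

/-- Iterated multiplication by `x`, for a multiplication `P` with unit `0`. -/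
def localPow (P : E × E → E) (x : E) : ℕ → E
  | 0 => 0
  | m + 1 => P (localPow P x m, x)

/-- For a `C²` multiplication with unit `0`, the `m`-th power map is close to `x ↦ m • x`, on a ball
whose radius is inversely proportional to `m`. -/
theorem exists_localPow_approx {P : E × E → E} (hP : ContDiffAt ℝ 2 P 0)
    (hl : ∀ᶠ x in 𝓝 (0 : E), P (x, 0) = x) (hr : ∀ᶠ x in 𝓝 (0 : E), P (0, x) = x)
    {δ : ℝ} (hδ : 0 < δ) :
    ∃ r > 0, r < δ ∧ ∀ N : ℕ, 0 < N → ∀ m ≤ N, ∀ x y : E, ‖x‖ ≤ r / N → ‖y‖ ≤ r / N →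
      ‖localPow P x m‖ < δ ∧
      ‖localPow P x m - localPow P y m - (m : ℝ) • (x - y)‖ ≤ m / 2 * ‖x - y‖ := by
  obtain ⟨C, hC, ρ, hρ, hmix⟩ := hP.exists_norm_mixed_difference_le
  obtain ⟨σ, hσ, hunit⟩ := Metric.eventually_nhds_iff_ball.1 (hl.and hr)
  set τ := min (min ρ σ) δ
  have hτ : 0 < τ := by positivity
  -- Iterates have norm at most `3 / 2 * r < τ`; each multiplication adds an error of at most `3 * C
  -- * r * ‖x - y‖`, hence half of `‖x - y‖`.
  obtain ⟨r, hr0, hr1, hr2⟩ : ∃ r > 0, 2 * r < τ ∧ 6 * C * r ≤ 1 := by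
    refine ⟨min (τ / 4) (1 / (6 * C + 1)), by positivity, ?_, ?_⟩
    · linarith [min_le_left (τ / 4) (1 / (6 * C + 1))]
    · have h := mul_le_mul_of_nonneg_left (min_le_right (τ / 4) (1 / (6 * C + 1)))
        (by positivity : 0 ≤ 6 * C)
      refine h.trans ?_
      rw [mul_one_div, div_le_one (by positivity)]
      linarith
  have hτδ : τ ≤ δ := min_le_right _ _
  have hτρ : τ ≤ ρ := (min_le_left _ _).trans (min_le_left _ _)
  have hτσ : τ ≤ σ := (min_le_left _ _).trans (min_le_right _ _)
  have hP0 : P (0, 0) = 0 := (hunit 0 (mem_ball_self hσ)).1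
  have h0 : ∀ m, localPow P 0 m = 0 := fun m => by
    induction m with
    | zero => rfl
    | succ m ih => rw [localPow, ih, hP0]
  have hprod : ∀ a b x y : E, ‖a‖ < τ → ‖b‖ < τ → ‖x‖ < τ → ‖y‖ < τ →
      ‖P (a, x) - P (b, y) - (a - b) - (x - y)‖ ≤ C * ‖a - b‖ * ‖x‖ + C * ‖b‖ * ‖x - y‖ := by
    intro a b x y ha hb hx hy
    have e1 := hmix a b x 0 (by linarith) (by linarith) (by linarith) (by simpa)
    have e2 := hmix b 0 x y (by linarith) (by simpa) (by linarith) (by linarith)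
    rw [(hunit a (by simpa using ha.trans_le hτσ)).1,
      (hunit b (by simpa using hb.trans_le hτσ)).1, sub_zero] at e1
    rw [(hunit x (by simpa using hx.trans_le hτσ)).2,
      (hunit y (by simpa using hy.trans_le hτσ)).2, sub_zero] at e2
    refine le_trans (le_of_eq ?_) ((norm_add_le _ _).trans (add_le_add e1 e2))
    congr 1; abel
  refine ⟨r, hr0, by linarith, fun N hN => ?_⟩
  have hN' : (1 : ℝ) ≤ N := by exact_mod_cast hN
  have hrN : r / N ≤ r := div_le_self hr0.le hN'
  have bound : ∀ m ≤ N, ∀ x : E, ‖x‖ ≤ r / N →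
      ‖localPow P x m - localPow P 0 m - (m : ℝ) • (x - 0)‖ ≤ m / 2 * ‖x - 0‖ →
      ‖localPow P x m‖ ≤ 3 / 2 * r := by
    intro m hm x hx h
    rw [h0, sub_zero, sub_zero] at h
    have h1 : ‖localPow P x m‖ ≤ m / 2 * ‖x‖ + m * ‖x‖ := by
      calc _ = ‖(localPow P x m - (m : ℝ) • x) + (m : ℝ) • x‖ := by rw [sub_add_cancel]
        _ ≤ _ := (norm_add_le _ _).trans (add_le_add h (by simp [norm_smul]))
    have h2 : (m : ℝ) * ‖x‖ ≤ r := by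
      calc (m : ℝ) * ‖x‖ ≤ N * (r / N) := by gcongr
        _ = r := by field_simp
    linarith
  have main : ∀ m ≤ N, ∀ x y : E, ‖x‖ ≤ r / N → ‖y‖ ≤ r / N →
      ‖localPow P x m - localPow P y m - (m : ℝ) • (x - y)‖ ≤ m / 2 * ‖x - y‖ := by
    intro m
    induction m with
    | zero => intro _ x y _ _; simp [localPow]
    | succ m ih =>
      intro hm x y hx hy
      have hm' : m ≤ N := by omega
      have hz : ‖(0 : E)‖ ≤ r / N := by simp; positivity
      have bx := bound m hm' x hx (ih hm' x 0 hx hz)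
      have bY := bound m hm' y hy (ih hm' y 0 hy hz)
      have hxy := ih hm' x y hx hy
      have hp := hprod _ _ x y (bx.trans_lt (by linarith)) (bY.trans_lt (by linarith))
        (by linarith) (by linarith)
      have hdiff : ‖localPow P x m - localPow P y m‖ ≤ 3 / 2 * m * ‖x - y‖ := by
        calc _ = ‖(localPow P x m - localPow P y m - (m : ℝ) • (x - y)) + (m : ℝ) • (x - y)‖ := by
              rw [sub_add_cancel]
          _ ≤ m / 2 * ‖x - y‖ + m * ‖x - y‖ :=
              (norm_add_le _ _).trans (add_le_add hxy (by simp [norm_smul]))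
          _ = _ := by ring
      have hmr : (m : ℝ) * ‖x‖ ≤ r := by
        calc (m : ℝ) * ‖x‖ ≤ N * (r / N) := by gcongr
          _ = r := by field_simp
      have k1 : C * ‖localPow P x m - localPow P y m‖ * ‖x‖ ≤ 3 / 2 * (C * r) * ‖x - y‖ := by
        calc _ ≤ C * (3 / 2 * m * ‖x - y‖) * ‖x‖ := by gcongr
          _ = 3 / 2 * C * ‖x - y‖ * (m * ‖x‖) := by ring
          _ ≤ 3 / 2 * C * ‖x - y‖ * r := by gcongr
          _ = _ := by ring
      have k2 : C * ‖localPow P y m‖ * ‖x - y‖ ≤ 3 / 2 * (C * r) * ‖x - y‖ := by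
        calc _ ≤ C * (3 / 2 * r) * ‖x - y‖ := by gcongr
          _ = _ := by ring
      have k3 : 3 * (C * r) * ‖x - y‖ ≤ 1 / 2 * ‖x - y‖ := by
        gcongr; linarith
      have e : localPow P x (m + 1) - localPow P y (m + 1) - ((m + 1 : ℕ) : ℝ) • (x - y) =
          (P (localPow P x m, x) - P (localPow P y m, y) -
            (localPow P x m - localPow P y m) - (x - y)) +
          (localPow P x m - localPow P y m - (m : ℝ) • (x - y)) := by
        rw [localPow, localPow, Nat.cast_succ, add_smul, one_smul]; abel
      rw [e, Nat.cast_succ]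
      refine (norm_add_le _ _).trans ?_
      linarith
  refine fun m hm x y hx hy => ⟨?_, main m hm x y hx hy⟩
  have := bound m hm x hx (main m hm x 0 hx (by simp; positivity))
  linarith

/-- A map of the closed ball of radius `s` that is close to `x ↦ N • x` and fixes `0` is injective
on that ball and attains all values of norm at most `N * s / 2`. -/
theorem exists_preimage_of_approx_smul [CompleteSpace E] {f : E → E} {N s : ℝ} (hN : 0 < N)
    (h0 : f 0 = 0)
    (hf : ∀ x y, ‖x‖ ≤ s → ‖y‖ ≤ s → ‖f x - f y - N • (x - y)‖ ≤ N / 2 * ‖x - y‖) {a : E}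
    (ha : 2 * ‖a‖ / N ≤ s) : ∃ x, ‖x‖ ≤ 2 * ‖a‖ / N ∧ f x = a := by
  set ρ := 2 * ‖a‖ / N with hρ
  have hρ0 : 0 ≤ ρ := by positivity
  -- Newton iteration with the derivative frozen at `N`: its fixed points solve `f x = a`.
  set g : E → E := fun x => x + N⁻¹ • (a - f x) with hg
  have hgd : ∀ x y, ‖x‖ ≤ s → ‖y‖ ≤ s → ‖g x - g y‖ ≤ 1 / 2 * ‖x - y‖ := by
    intro x y hx hy
    have e : g x - g y = -(N⁻¹ • (f x - f y - N • (x - y))) := by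
      simp only [hg, smul_sub, smul_smul, inv_mul_cancel₀ hN.ne', one_smul]; abel
    rw [e, norm_neg, norm_smul, norm_inv, Real.norm_of_nonneg hN.le]
    calc _ ≤ N⁻¹ * (N / 2 * ‖x - y‖) := by gcongr; exact hf x y hx hy
      _ = _ := by field_simp
  have hmaps : Set.MapsTo g (closedBall 0 ρ) (closedBall 0 ρ) := by
    intro x hx
    rw [mem_closedBall_zero_iff] at hx ⊢
    have h1 := hgd x 0 (hx.trans ha) (by simpa using hρ0.trans ha)
    have h2 : ‖g 0‖ = ρ / 2 := by
      simp only [hg, h0, sub_zero, zero_add, norm_smul, norm_inv, Real.norm_of_nonneg hN.le, hρ]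
      field_simp
    have h3 := norm_add_le (g x - g 0) (g 0)
    rw [sub_add_cancel] at h3
    rw [sub_zero] at h1
    linarith
  have hcontr : ContractingWith (1 / 2) (hmaps.restrict g _ _) := by
    refine ⟨by norm_num, LipschitzWith.of_dist_le_mul fun x y => ?_⟩
    have h := hgd x y ((mem_closedBall_zero_iff.1 x.2).trans ha)
      ((mem_closedBall_zero_iff.1 y.2).trans ha)
    rw [Subtype.dist_eq, Subtype.dist_eq, dist_eq_norm, dist_eq_norm]
    simpa using h
  obtain ⟨x, hx, hfix, -⟩ := hcontr.exists_fixedPoint' isClosed_closedBall.isComplete hmaps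
    (mem_closedBall_self hρ0) (edist_ne_top _ _)
  refine ⟨x, mem_closedBall_zero_iff.1 hx, ?_⟩
  have h : N⁻¹ • (a - f x) = 0 := by simpa [hg, Function.IsFixedPt] using hfix
  rw [smul_eq_zero, inv_eq_zero, sub_eq_zero] at h
  exact (h.resolve_left hN.ne').symm

/-- When the values agree, the error is all of `N * ‖x - y‖`, twice what is allowed. -/
theorem eq_of_approx_smul {f : E → E} {N : ℝ} (hN : 0 < N) {x y : E}
    (hf : ‖f x - f y - N • (x - y)‖ ≤ N / 2 * ‖x - y‖) (h : f x = f y) : x = y := by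
  rw [h, sub_self, zero_sub, norm_neg, norm_smul, Real.norm_of_nonneg hN.le] at hf
  rw [← sub_eq_zero, ← norm_eq_zero]
  nlinarith [norm_nonneg (x - y)]

end LocalPowers

/-! ### Small roots in a Lie group. -/

section LieGroupRoots

variable {E : Type*} [NormedAddCommGroup E] [NormedSpace ℝ E]
  {H : Type*} [TopologicalSpace H] (I : ModelWithCorners ℝ E H) [I.Boundaryless]

/-- A chart of a manifold at a point, centred at the origin of the model space. -/
theorem exists_centered_chart {M : Type*} [TopologicalSpace M] [ChartedSpace H M]
    [IsManifold I ∞ M] (p : M) :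
    ∃ (φ : M → E) (ψ : E → M), φ p = 0 ∧ ψ 0 = p ∧
      ContMDiffAt I 𝓘(ℝ, E) ∞ φ p ∧ (∀ᶠ x in 𝓝 0, ContMDiffAt 𝓘(ℝ, E) I ∞ ψ x) ∧
      (∀ᶠ x in 𝓝 0, φ (ψ x) = x) ∧ ∀ᶠ q in 𝓝 p, ψ (φ q) = q := by
  set e := extChartAt I p with he
  have hshift : Tendsto (fun x => x + e p) (𝓝 0) (𝓝 (e p)) := by
    simpa only [zero_add] using (continuous_add_const (e p)).tendsto 0
  have htarget : ∀ᶠ x in 𝓝 (0 : E), x + e p ∈ e.target :=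
    hshift.eventually (extChartAt_target_mem_nhds p)
  refine ⟨fun q => e q - e p, fun x => e.symm (x + e p), sub_self _, ?_, ?_, ?_, ?_, ?_⟩
  · change e.symm (0 + e p) = p
    rw [zero_add, he, extChartAt_to_inv]
  · exact contMDiffAt_extChartAt.sub contMDiffAt_const
  · filter_upwards [htarget] with x hx
    have h1 : ContMDiffAt 𝓘(ℝ, E) I ∞ e.symm (x + e p) :=
      (contMDiffOn_extChartAt_symm p).contMDiffAt ((isOpen_extChartAt_target p).mem_nhds hx)
    have h2 : ContMDiffAt 𝓘(ℝ, E) 𝓘(ℝ, E) ∞ (fun x : E => x + e p) x :=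
      (contDiff_id.add contDiff_const).contMDiff.contMDiffAt
    exact h1.comp x h2
  · filter_upwards [htarget] with x hx
    rw [e.right_inv hx, add_sub_cancel_right]
  · filter_upwards [extChartAt_source_mem_nhds (I := I) p] with q hq
    rw [sub_add_cancel, e.left_inv hq]

variable [CompleteSpace E] {G : Type*} [Group G] [TopologicalSpace G] [ChartedSpace H G]
  [LieGroup I ∞ G]

/-- Elements of a Lie group near `1` have roots of all orders in the identity component, which are
canonical enough to be fixed by each smooth power-preserving map fixing the element, as soon as the
element lies in a neighbourhood of `1` that does not depend on the order of the root. -/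
theorem LieGroup.exists_uniform_roots :
    ∃ root : ℕ → G → G,
      (∀ᶠ a in 𝓝 (1 : G), ∀ m, 0 < m → root m a ^ m = a ∧ root m a ∈ connectedComponent 1) ∧
      ∀ Θ : G → G, ContMDiffAt I I ∞ Θ 1 → (∀ x (m : ℕ), Θ (x ^ m) = Θ x ^ m) →
        ∀ᶠ a in 𝓝 (1 : G), ∀ m, 0 < m → Θ a = a → Θ (root m a) = root m a := by
  obtain ⟨φ, ψ, hφ1, hψ0, hφ, hψ, hφψ, hψφ⟩ := exists_centered_chart I (1 : G)
  have hφ' : Tendsto φ (𝓝 1) (𝓝 0) := by simpa [ContinuousAt, hφ1] using hφ.continuousAt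
  have hψat := hψ.self_of_nhds
  have hψ' : Tendsto ψ (𝓝 0) (𝓝 1) := by simpa [ContinuousAt, hψ0] using hψat.continuousAt
  set P : E × E → E := fun z => φ (ψ z.1 * ψ z.2) with hPdef
  have hmulM : ContMDiffAt 𝓘(ℝ, E × E) I ∞ (fun z : E × E => ψ z.1 * ψ z.2) 0 := by
    have h1 : ContMDiffAt 𝓘(ℝ, E × E) I ∞ (fun z : E × E => ψ z.1) 0 :=
      ContMDiffAt.comp (g := ψ) (0 : E × E) hψat contDiff_fst.contMDiff.contMDiffAt
    have h2 : ContMDiffAt 𝓘(ℝ, E × E) I ∞ (fun z : E × E => ψ z.2) 0 :=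
      ContMDiffAt.comp (g := ψ) (0 : E × E) hψat contDiff_snd.contMDiff.contMDiffAt
    exact h1.mul h2
  have hmul0 : (fun z : E × E => ψ z.1 * ψ z.2) 0 = 1 := by simp [hψ0]
  have hP : ContDiffAt ℝ 2 P 0 := by
    have h : ContMDiffAt 𝓘(ℝ, E × E) 𝓘(ℝ, E) ∞ P 0 :=
      ContMDiffAt.comp_of_eq hφ hmulM hmul0
    exact h.contDiffAt.of_le (WithTop.coe_le_coe.2 le_top)
  have hψP : ∀ᶠ z in 𝓝 (0 : E × E), ψ (P z) = ψ z.1 * ψ z.2 := by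
    have h : Tendsto (fun z : E × E => ψ z.1 * ψ z.2) (𝓝 0) (𝓝 1) := by
      simpa only [ContinuousAt, hmul0] using hmulM.continuousAt
    exact h.eventually hψφ
  obtain ⟨δ₁, hδ₁, hball₁⟩ := Metric.eventually_nhds_iff_ball.1 hψP
  obtain ⟨δ₂, hδ₂, hball₂⟩ := Metric.eventually_nhds_iff_ball.1 (hφψ.and hψ)
  set δ := min δ₁ δ₂
  have hδ : 0 < δ := lt_min hδ₁ hδ₂
  have hPmul : ∀ x y : E, ‖x‖ < δ → ‖y‖ < δ → ψ (P (x, y)) = ψ x * ψ y := fun x y hx hy =>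
    hball₁ (x, y) (by
      rw [mem_ball_zero_iff, Prod.norm_def]
      exact (max_lt hx hy).trans_le (min_le_left _ _))
  have hinv : ∀ x : E, ‖x‖ < δ → φ (ψ x) = x := fun x hx =>
    (hball₂ x (mem_ball_zero_iff.2 (hx.trans_le (min_le_right _ _)))).1
  obtain ⟨r, hr, hrδ, happrox⟩ := exists_localPow_approx hP
    (hφψ.mono fun x hx => by simpa [hPdef, hψ0] using hx)
    (hφψ.mono fun x hx => by simpa [hPdef, hψ0] using hx) hδ
  have hlt : ∀ m : ℕ, 0 < m → ∀ x : E, ‖x‖ ≤ r / m → ‖x‖ < δ := fun m hm x hx =>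
    (hx.trans (div_le_self hr.le (by exact_mod_cast hm))).trans_lt hrδ
  have hpow : ∀ N : ℕ, 0 < N → ∀ x : E, ‖x‖ ≤ r / N → ∀ m ≤ N, ψ (localPow P x m) = ψ x ^ m := by
    intro N hN x hx m
    induction m with
    | zero => intro _; rw [localPow, hψ0, pow_zero]
    | succ m ih =>
      intro hm
      rw [localPow, hPmul _ _ (happrox N hN m (by omega) x x hx hx).1 (hlt N hN x hx),
        ih (by omega), pow_succ]
  -- The conditions sit inside the existential so that the choice is total, with `0` as default.
  have hroot : ∀ (m : ℕ) (a : G), ∃ x : E, 0 < m → ‖φ a‖ ≤ r / 2 →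
      ‖x‖ ≤ 2 * ‖φ a‖ / m ∧ ‖x‖ ≤ r / m ∧ localPow P x m = φ a := by
    intro m a
    by_cases h : 0 < m ∧ ‖φ a‖ ≤ r / 2
    · obtain ⟨hm, ha⟩ := h
      have hm' : (0 : ℝ) < m := by exact_mod_cast hm
      have hle : 2 * ‖φ a‖ / m ≤ r / m := by gcongr; linarith
      have hP00 : P (0, 0) = 0 := by simp [hPdef, hψ0, hφ1]
      have hz : localPow P 0 m = 0 := by
        clear hm hm' hle
        induction m with
        | zero => rfl
        | succ m ih => rw [localPow, ih, hP00]
      obtain ⟨x, hx, hxa⟩ := exists_preimage_of_approx_smul (f := fun x => localPow P x m) hm' hz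
        (fun x y hx hy => (happrox m hm m le_rfl x y hx hy).2) hle
      exact ⟨x, fun _ _ => ⟨hx, hx.trans hle, hxa⟩⟩
    · exact ⟨0, fun hm ha => absurd ⟨hm, ha⟩ h⟩
  choose ξ hξ using hroot
  have hnorm : ∀ ε > 0, ∀ᶠ a in 𝓝 (1 : G), ‖φ a‖ < ε := fun ε hε => by
    simpa using hφ'.eventually (ball_mem_nhds 0 hε)
  have hsmall := (hnorm (r / 2) (by positivity)).and hψφ
  have hξpow : ∀ m : ℕ, 0 < m → ∀ a, ‖φ a‖ < r / 2 ∧ ψ (φ a) = a → ψ (ξ m a) ^ m = a := by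
    intro m hm a ha
    obtain ⟨-, h2, h3⟩ := hξ m a hm ha.1.le
    rw [← hpow m hm _ h2 m le_rfl, h3, ha.2]
  refine ⟨fun m a => ψ (ξ m a), ?_, fun Θ hΘ hΘpow => ?_⟩
  · filter_upwards [hsmall] with a ha m hm
    refine ⟨hξpow m hm a ha, ?_⟩
    have hconn : IsPreconnected (ψ '' ball 0 δ) :=
      (convex_ball (0 : E) δ).isPreconnected.image ψ fun x hx =>
        (hball₂ x (ball_subset_ball (min_le_right _ _) hx)).2.continuousAt.continuousWithinAt
    refine hconn.subset_connectedComponent ⟨0, mem_ball_self hδ, hψ0⟩ ⟨ξ m a, ?_, rfl⟩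
    exact mem_ball_zero_iff.2 (hlt m hm _ (hξ m a hm ha.1.le).2.1)
  · have hΘ1 : Θ 1 = 1 := by simpa using hΘpow 1 0
    have hTM : ContMDiffAt 𝓘(ℝ, E) I ∞ (fun x => Θ (ψ x)) 0 := ContMDiffAt.comp_of_eq hΘ hψat hψ0
    have hT1 : (fun x => Θ (ψ x)) 0 = 1 := by simp [hψ0, hΘ1]
    have hT : ContDiffAt ℝ 1 (fun x => φ (Θ (ψ x))) 0 := by
      have h : ContMDiffAt 𝓘(ℝ, E) 𝓘(ℝ, E) ∞ (fun x => φ (Θ (ψ x))) 0 :=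
        ContMDiffAt.comp_of_eq hφ hTM hT1
      exact h.contDiffAt.of_le (WithTop.coe_le_coe.2 le_top)
    have hψT : ∀ᶠ x in 𝓝 (0 : E), ψ (φ (Θ (ψ x))) = Θ (ψ x) := by
      have h : Tendsto (fun x => Θ (ψ x)) (𝓝 0) (𝓝 1) := by
        simpa only [ContinuousAt, hT1] using hTM.continuousAt
      exact h.eventually hψφ
    obtain ⟨K, t, ht, hK⟩ := hT.exists_lipschitzOnWith
    obtain ⟨η, hη, hballη⟩ := Metric.eventually_nhds_iff_ball.1 (hψT.and ht)
    -- The bound on `‖φ a‖` does not involve `m`, yet keeps the image of the root under `Θ` in the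
    -- ball of radius `r / m`, where roots are unique; `K + 1` avoids division by zero.
    filter_upwards [hsmall, hnorm (η / 2) (by positivity),
      hnorm (r / (2 * (K + 1))) (by positivity)] with a ha haη haK m hm hfix
    obtain ⟨h1, h2, h3⟩ := hξ m a hm ha.1.le
    have hm' : (1 : ℝ) ≤ m := by exact_mod_cast hm
    have hxη : ‖ξ m a‖ < η :=
      (h1.trans (div_le_self (by positivity) hm')).trans_lt (by linarith)
    obtain ⟨hψy, hxt⟩ := hballη _ (mem_ball_zero_iff.2 hxη)
    set y := φ (Θ (ψ (ξ m a))) with hy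
    have hyr : ‖y‖ ≤ r / m := by
      have h := hK.norm_sub_le hxt (hballη 0 (mem_ball_self hη)).2
      simp only [hψ0, hΘ1, hφ1, sub_zero] at h
      rw [lt_div_iff₀ (by positivity)] at haK
      calc ‖y‖ ≤ K * ‖ξ m a‖ := h
        _ ≤ (K + 1) * (2 * ‖φ a‖ / m) := by gcongr; linarith
        _ = ‖φ a‖ * (2 * (K + 1)) / m := by ring
        _ ≤ r / m := by gcongr
    have heq : ψ (localPow P y m) = ψ (localPow P (ξ m a) m) := by
      rw [hpow m hm y hyr m le_rfl, hψy, ← hΘpow, hξpow m hm a ha, hfix, h3, ha.2]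
    have heq' : localPow P y m = localPow P (ξ m a) m := by
      have := congrArg φ heq
      rwa [hinv _ (happrox m hm m le_rfl y y hyr hyr).1,
        hinv _ (happrox m hm m le_rfl _ _ h2 h2).1] at this
    have hyx : y = ξ m a := eq_of_approx_smul (f := fun x => localPow P x m) (by linarith)
      (happrox m hm m le_rfl _ _ hyr h2).2 heq'
    change Θ (ψ (ξ m a)) = ψ (ξ m a)
    rw [← hψy, hyx]

end LieGroupRoots

/-! ### The conjugating element. -/

theorem lemma6p2
    {E : Type*} [NormedAddCommGroup E] [NormedSpace ℝ E] [FiniteDimensional ℝ E]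
    {H : Type*} [TopologicalSpace H] (I : ModelWithCorners ℝ E H) [I.Boundaryless]
    {G : Type*} [Group G] [TopologicalSpace G] [ChartedSpace H G] [LieGroup I ∞ G]
    [T2Space G] [CompactSpace G]
    (gp gm : G) (hsq : gp ^ 2 = gm ^ 2) :
    ∃ h ∈ connectedComponent (1 : G), IsOfFinOrder ((h * gm * h⁻¹)⁻¹ * gp) := by
  have : CompleteSpace E := FiniteDimensional.complete ℝ E
  have : IsTopologicalGroup G := topologicalGroup_of_lieGroup I ∞
  obtain ⟨root, hroot, hfix⟩ := LieGroup.exists_uniform_roots I (G := G)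
  set A := gm⁻¹ * gp with hA
  -- `gp` inverts `A`
  have hgpA : (gp * A * gp⁻¹)⁻¹ = A := by
    have h : gp * gp = gm * gm := by simpa [sq] using hsq
    calc (gp * A * gp⁻¹)⁻¹ = gm⁻¹ * (gm * gm) * gp⁻¹ := by rw [hA]; group
      _ = A := by rw [← h, hA]; group
  have hΘ₁ := hfix (fun x => A * x * A⁻¹)
    ((contMDiffAt_const.mul contMDiffAt_id).mul contMDiffAt_const)
    (fun x m => conj_pow.symm)
  -- This map reverses products, but it preserves powers, which is all that is needed.
  have hΘ₂ := hfix (fun x => (gp * x * gp⁻¹)⁻¹)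
    ((contMDiffAt_const.mul contMDiffAt_id).mul contMDiffAt_const).inv
    (fun x m => by rw [← conj_pow, inv_pow])
  obtain ⟨n, ⟨⟨hr, h₁⟩, h₂⟩, hn⟩ := (((mapClusterPt_one_atTop_pow A⁻¹).frequently
    ((hroot.and hΘ₁).and hΘ₂)).and_eventually (eventually_gt_atTop 0)).exists
  obtain ⟨hpow, hcomp⟩ := hr (2 * n) (by omega)
  have hcA : A * root (2 * n) (A⁻¹ ^ n) * A⁻¹ = root (2 * n) (A⁻¹ ^ n) :=
    h₁ (2 * n) (by omega) (by rw [← conj_pow, mul_inv_cancel, one_mul])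
  have hcg : (gp * root (2 * n) (A⁻¹ ^ n) * gp⁻¹)⁻¹ = root (2 * n) (A⁻¹ ^ n) := by
    refine h₂ (2 * n) (by omega) ?_
    have : gp * A⁻¹ * gp⁻¹ = A := by simpa [mul_assoc] using hgpA
    rw [← conj_pow, this, inv_pow]
  set h := root (2 * n) (A⁻¹ ^ n)
  refine ⟨h, hcomp, isOfFinOrder_iff_pow_eq_one.2 ⟨n, hn, ?_⟩⟩
  have hcomm : Commute A h := mul_inv_eq_iff_eq_mul.1 hcA
  have hgh : h⁻¹ * gp = gp * h := by
    rw [inv_eq_iff_eq_inv, mul_inv_eq_iff_eq_mul] at hcg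
    exact hcg.symm
  have e : (h * gm * h⁻¹)⁻¹ * gp = A * h ^ 2 := by
    calc (h * gm * h⁻¹)⁻¹ * gp = h * gm⁻¹ * (h⁻¹ * gp) := by group
      _ = h * A * h := by rw [hgh, hA]; group
      _ = A * h ^ 2 := by rw [← hcomm.eq, sq, mul_assoc]
  rw [e, (hcomm.pow_right 2).mul_pow, ← pow_mul, hpow, inv_pow, mul_inv_cancel]
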